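/- Let $n^{(1)},n^{(2)}\in\mathbb R^3$ be orthonormal, and let $\mathcal D_4$ be the tetragonal group, i.e. the eight rotations $Q\in\mathrm{SO}(3)$ that map the set $\{\pm n^{(1)},\pm n^{(2)}\}$ onto itself. For $F\in\mathbb R^{3\times3}$ with $\det F>0$ let $C=F^TF$, which ranges over the symmetric positive definite matrices $\mathrm{SYM}^+(3)$, and let $G=\operatorname{cof}C=\det(C)\,C^{-T}$. Write $A:B=\sum_{ij}A_{ij}B_{ij}$ and $(\mathbb M:A)_{ij}=\sum_{kl}\mathbb M_{ijkl}A_{kl}$, and put $\mathbb M=\sum_{i=1}^2 n^{(i)}\otimes n^{(i)}\otimes n^{(i)}\otimes n^{(i)}$. A function $f(C)$ is called *polynomial* if it is a polynomial in the entries of $C$ on $\mathrm{SYM}^+(3)$, an *invariant* of $\mathcal D_4$ if $f(QCQ^T)=f(C)$ for all $Q\in\mathcal D_4$ and $C\in\mathrm{SYM}^+(3)$, and *polyconvex* if there is a convex function $P:\mathbb R^{3\times 3}\times\mathbb R^{3\times3}\times\mathbb R\to\mathbb R$ with $f(F^TF)=P(F,\operatorname{cof}F,\det F)$ whenever $\det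 F>0$. A tuple of polynomial invariants of $\mathcal D_4$ is an *integrity basis* if every polynomial invariant of $\mathcal D_4$ is a polynomial in the invariants of the tuple. Define $$I_1^{\rm iso}=\operatorname{tr}C,\quad I_2^{\rm iso}=\operatorname{tr}G,\quad I_3^{\rm iso}=\det C,$$ $$I_1^{\rm tet}=\sum_{i=1}^2 n^{(i)}\otimes n^{(i)}:C,\quad I_2^{\rm tet}=\sum_{i=1}^2\big[n^{(i)}\otimes n^{(i)}:C\big]^2,\quad I_3^{\rm tet}=\sum_{i=1}^2 n^{(i)}\otimes n^{(i)}:G,$$ $$I_4^{\rm tet}=\sum_{i=1}^2\big[n^{(i)}\otimes n^{(i)}:G\big]^2,\quad I_5^{\rm tet}=\sum_{i=1}^2\big(n^{(i)}\otimes n^{(i)}:C+n^{(i)}\otimes n^{(i)}:G\big)^2,$$ and $$J_k^{\rm iso}=\operatorname{tr}C^k\ (k=1,2,3),\quad J_1^{\rm tet}=\operatorname{tr}(\mathbb M:C),\quad J_2^{\rm tet}=\operatorname{tr}\big((\mathbb M:C)^2\big),\quad J_3^{\rm tet}=\operatorname{tr}(\mathbb M:C^2),$$ $$J_4^{\rm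 tet}=\operatorname{tr}\big(C^2(\mathbb M:C)\big),\quad J_5^{\rm tet}=\operatorname{tr}\big((\mathbb M:C^2)^2\big).$$ Then: 1. $I_1^{\rm tet},\dots,I_5^{\rm tet}$ and $I_1^{\rm iso},I_2^{\rm iso},I_3^{\rm iso}$ are polyconvex. 2. $(I_1^{\rm tet},\dots,I_5^{\rm tet},I_1^{\rm iso},I_2^{\rm iso},I_3^{\rm iso})$ is an integrity basis for $\mathcal D_4$; in particular, its members are invariants of $\mathcal D_4$. 3. On $\mathrm{SYM}^+(3)$, each of $J_1^{\rm tet},\dots,J_5^{\rm tet},J_1^{\rm iso},J_2^{\rm iso}$ is a real polynomial in $I_1^{\rm tet},\dots,I_5^{\rm tet},I_1^{\rm iso},I_2^{\rm iso}$, and each of $J_1^{\rm iso},J_2^{\rm iso},J_3^{\rm iso}$ is a real polynomial in $I_1^{\rm iso},I_2^{\rm iso},I_3^{\rm iso}$. 4. Conversely, on $\mathrm{SYM}^+(3)$, each of $I_1^{\rm tet},\dots,I_5^{\rm tet}$ is a real polynomial in $J_1^{\rm tet},\dots,J_5^{\rm tet},J_1^{\rm iso},J_2^{\rm iso}$, and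 each of $I_1^{\rm iso},I_2^{\rm iso},I_3^{\rm iso}$ is a real polynomial in $J_1^{\rm iso},J_2^{\rm iso},J_3^{\rm iso}$. -/

import Mathlib

open scoped Matrix

noncomputable section

/-- Second-order tensors on `ℝ³`, in a fixed Cartesian coordinate system. -/
abbrev Tensor2 : Type := Matrix (Fin 3) (Fin 3) ℝ

/-- Fourth-order tensors on `ℝ³`. -/
abbrev Tensor4 : Type := Fin 3 → Fin 3 → Fin 3 → Fin 3 → ℝ

/-- The double contraction `A : B = A_{ij} B_{ij}`. -/
def ddot (A B : Tensor2) : ℝ := ∑ i, ∑ j, A i j * B i j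

/-- The double contraction `(𝕄 : A)_{ij} = 𝕄_{ijkl} A_{kl}`. -/
def contract (M : Tensor4) (A : Tensor2) : Tensor2 :=
  Matrix.of fun i j => ∑ k, ∑ l, M i j k l * A k l

/-- The cofactor of a tensor. -/
def cof (A : Tensor2) : Tensor2 := A.adjugateᵀ

/-- On invertible tensors the cofactor is `det A • A⁻ᵀ`. -/
theorem cof_eq_det_smul (A : Tensor2) (hA : A.det ≠ 0) : cof A = A.det • (A⁻¹)ᵀ := by
  rw [cof, Matrix.inv_def, Matrix.transpose_smul, smul_smul, Ring.inverse_eq_inv',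
    mul_inv_cancel₀ hA, one_smul]

/-- The vertices `± n⁽¹⁾, ± n⁽²⁾` of a square. -/
def squareVertices (n : Fin 2 → Fin 3 → ℝ) : Set (Fin 3 → ℝ) :=
  {n 0, -n 0, n 1, -n 1}

/-- The tetragonal group `D₄` with preferred directions `n⁽¹⁾, n⁽²⁾`: the rotations that map the
square with vertices `± n⁽¹⁾, ± n⁽²⁾` onto itself (eight rotations, if `n⁽¹⁾, n⁽²⁾` are
orthonormal). -/
def groupD4 (n : Fin 2 → Fin 3 → ℝ) : Subgroup (Matrix.specialOrthogonalGroup (Fin 3) ℝ) where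
  carrier := {Q | (fun v => (Q : Tensor2) *ᵥ v) '' squareVertices n = squareVertices n}
  one_mem' := by simp
  mul_mem' := by
    intro P Q hP hQ
    simp only [Set.mem_ofPred_eq] at hP hQ ⊢
    conv_rhs => rw [← hP, ← hQ, Set.image_image]
    simp [Matrix.mulVec_mulVec]
  inv_mem' := by
    intro Q hQ
    simp only [Set.mem_ofPred_eq] at hQ ⊢
    conv_lhs => rw [← hQ, Set.image_image]
    have h : ((Q⁻¹ : Matrix.specialOrthogonalGroup (Fin 3) ℝ) : Tensor2) * (Q : Tensor2) = 1 :=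
      congrArg Subtype.val (inv_mul_cancel Q)
    simp only [Matrix.mulVec_mulVec, h, Matrix.one_mulVec, Set.image_id']

/-- A function `f` of the right Cauchy-Green tensor `C ∈ SYM⁺(3)` is an invariant of the group `G`
if `f (Q C Qᵀ) = f C`. For `C = Fᵀ F`, the tensor `Q C Qᵀ` belongs to the deformation
gradient `F Qᵀ`, so this is the material symmetry condition. -/
def IsInvariantOf (G : Subgroup (Matrix.specialOrthogonalGroup (Fin 3) ℝ)) (f : Tensor2 → ℝ) :
    Prop :=
  ∀ Q ∈ G, ∀ C : Tensor2, C.PosDef → f ((Q : Tensor2) * C * (Q : Tensor2)ᵀ) = f C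

/-- `f` can be represented on `SYM⁺(3)` as a real polynomial in the functions `I k`. -/
def IsPolynomialIn {ι : Type} (I : ι → Tensor2 → ℝ) (f : Tensor2 → ℝ) : Prop :=
  ∃ p : MvPolynomial ι ℝ, ∀ C : Tensor2, C.PosDef → f C = MvPolynomial.eval (fun k => I k C) p

/-- `f` is a polynomial function of the coordinates of `C ∈ SYM⁺(3)`. -/
def IsPolynomialFunction (f : Tensor2 → ℝ) : Prop :=
  IsPolynomialIn (fun (ij : Fin 3 × Fin 3) (C : Tensor2) => C ij.1 ij.2) f

/-- A tuple of polynomial invariants of `G` is an integrity basis if every polynomial invariant of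
`G` can be represented as a polynomial in the invariants of the tuple. -/
def IsIntegrityBasis (G : Subgroup (Matrix.specialOrthogonalGroup (Fin 3) ℝ)) {ι : Type}
    (I : ι → Tensor2 → ℝ) : Prop :=
  (∀ k, IsPolynomialFunction (I k) ∧ IsInvariantOf G (I k)) ∧
    ∀ f : Tensor2 → ℝ, IsPolynomialFunction f → IsInvariantOf G f → IsPolynomialIn I f

/-- A function `f` of `C = Fᵀ F` is polyconvex if `f (Fᵀ F) = P (F, cof F, det F)` for all
`F ∈ GL⁺(3)`, with a convex function `P`. -/
def IsPolyconvex (f : Tensor2 → ℝ) : Prop :=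
  ∃ P : Tensor2 × Tensor2 × ℝ → ℝ, ConvexOn ℝ Set.univ P ∧
    ∀ F : Tensor2, 0 < F.det → f (Fᵀ * F) = P (F, cof F, F.det)

/-- The tensors `n⁽ⁱ⁾ ⊗ n⁽ⁱ⁾`. -/
def dyadN (n : Fin 2 → Fin 3 → ℝ) (i : Fin 2) : Tensor2 := Matrix.vecMulVec (n i) (n i)

/-- The structural tensor `𝕄 = ∑ᵢ n⁽ⁱ⁾ ⊗ n⁽ⁱ⁾ ⊗ n⁽ⁱ⁾ ⊗ n⁽ⁱ⁾`. -/
def structTensor (n : Fin 2 → Fin 3 → ℝ) : Tensor4 :=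
  fun i j k l => ∑ a, n a i * n a j * n a k * n a l

/-- The isotropic invariants `tr C, tr C², tr C³`. -/
def Jiso : Fin 3 → Tensor2 → ℝ :=
  ![fun C => C.trace, fun C => (C ^ 2).trace, fun C => (C ^ 3).trace]

/-- The tetragonal invariants
`tr (𝕄:C), tr (𝕄:C)², tr (𝕄:C²), tr (C²·(𝕄:C)), tr (𝕄:C²)²`. -/
def Jtet (n : Fin 2 → Fin 3 → ℝ) : Fin 5 → Tensor2 → ℝ :=
  ![fun C => (contract (structTensor n) C).trace,
    fun C => (contract (structTensor n) C ^ 2).trace,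
    fun C => (contract (structTensor n) (C ^ 2)).trace,
    fun C => (C ^ 2 * contract (structTensor n) C).trace,
    fun C => (contract (structTensor n) (C ^ 2) ^ 2).trace]

/-- The isotropic invariants `tr C, tr G, det C` with `G = cof C`. -/
def Iiso : Fin 3 → Tensor2 → ℝ :=
  ![fun C => C.trace, fun C => (cof C).trace, fun C => C.det]

/-- The tetragonal invariants constructed by group symmetrization. -/
def Itet (n : Fin 2 → Fin 3 → ℝ) : Fin 5 → Tensor2 → ℝ :=
  ![fun C => ∑ i, ddot (dyadN n i) C,
    fun C => ∑ i, ddot (dyadN n i) C ^ 2,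
    fun C => ∑ i, ddot (dyadN n i) (cof C),
    fun C => ∑ i, ddot (dyadN n i) (cof C) ^ 2,
    fun C => ∑ i, (ddot (dyadN n i) C + ddot (dyadN n i) (cof C)) ^ 2]

end

/-!
Let `a, b, c, d, e, f` be the components `11, 22, 33, 12, 13, 23` of `C` in the orthonormal frame
`n⁽¹⁾, n⁽²⁾, n⁽¹⁾ × n⁽²⁾`. They are linear in `C`, determine `C`, and the change of frame is a
rotation, so that traces, determinants and cofactors can be computed in the frame
(`Itet_apply`, `Iiso_apply`, `Jtet_apply`, `Jiso_apply`).

*Polyconvexity.* From `v ⊗ v : FᵀF = |F v|²` and `cof (FᵀF) = (cof F)ᵀ (cof F)`, all invariants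
but `det C = (det F)²` are sums of `|F v|²` and `|(cof F) v|²`, or of squares of such nonnegative
convex functions.

*Comparison of the two systems.* Both the `I`-tuple and the `J`-tuple, each without its cubic
isotropic member, generate the same algebra as the seven functions `tetInvariant`, namely
`a + b, a b, c, d², e² + f², a e² + b f², e² f²`. The purely isotropic relations are Newton's
identities.

*Integrity basis.* The half turns in `D₄` about the frame axes change the signs of two of
`d, e, f` and fix `a, b, c`. Over the algebra `S` generated by `a, b, c, d², e², f², d e f`, every
polynomial is a combination of `1, d, e, f, d e, d f, e f` (`exists_sign_decomposition`), and
averaging over the half turns leaves only the coefficient of `1`; so an invariant polynomial lies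
in `S`. The quarter turn about the third axis exchanges `a` with `b` and `e²` with `f²`, and fixes
`c, d², d e f`. Over the algebra `A` generated by the `I`-tuple, which contains `tetInvariant` and,
through `det C`, also `d e f`, every element of `S` is a combination of `1, a - b, e² - f²`
(`exists_swap_decomposition`). The quarter turn changes the signs of `a - b` and `e² - f²`, hence an
invariant element of `S` lies in `A`. Conversely, `D₄` permutes the lines spanned by `n⁽¹⁾` and
`n⁽²⁾`, which makes the members of the `I`-tuple invariant.
-/

/-! ### Functions that are polynomial in a tuple -/

/-- The functions of `C` that coincide on `SYM⁺(3)` with a real polynomial in the tuple `I`, as a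
subalgebra of all functions of `C`. -/
def polynomialsIn {ι : Type} (I : ι → Tensor2 → ℝ) : Subalgebra ℝ (Tensor2 → ℝ) where
  carrier := {f | IsPolynomialIn I f}
  mul_mem' := by
    rintro f g ⟨p, hp⟩ ⟨q, hq⟩
    exact ⟨p * q, fun C hC => by simp [hp C hC, hq C hC]⟩
  add_mem' := by
    rintro f g ⟨p, hp⟩ ⟨q, hq⟩
    exact ⟨p + q, fun C hC => by simp [hp C hC, hq C hC]⟩
  algebraMap_mem' r := ⟨MvPolynomial.C r, fun C _ => by simp⟩

section PolynomialsIn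

variable {ι κ : Type} {I : ι → Tensor2 → ℝ} {J : κ → Tensor2 → ℝ} {f g : Tensor2 → ℝ}

theorem self_mem_polynomialsIn (I : ι → Tensor2 → ℝ) (k : ι) : I k ∈ polynomialsIn I :=
  ⟨MvPolynomial.X k, fun C _ => by simp⟩

theorem mem_polynomialsIn_of_eq (hg : g ∈ polynomialsIn I)
    (h : ∀ C : Tensor2, C.PosDef → f C = g C) : f ∈ polynomialsIn I := by
  obtain ⟨p, hp⟩ := hg
  exact ⟨p, fun C hC => (h C hC).trans (hp C hC)⟩

theorem aeval_tuple_apply (I : ι → Tensor2 → ℝ) (p : MvPolynomial ι ℝ) (C : Tensor2) :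
    MvPolynomial.aeval I p C = MvPolynomial.eval (fun k => I k C) p := by
  induction p using MvPolynomial.induction_on with
  | C r => simp
  | add p q hp hq => simp [hp, hq]
  | mul_X p k hp => simp [hp]

theorem polynomialsIn_trans (hf : f ∈ polynomialsIn J) (hJ : ∀ k, J k ∈ polynomialsIn I) :
    f ∈ polynomialsIn I := by
  obtain ⟨p, hp⟩ := hf
  refine mem_polynomialsIn_of_eq (g := MvPolynomial.aeval J p) ?_ fun C hC => by
    rw [hp C hC, aeval_tuple_apply]
  clear hp
  induction p using MvPolynomial.induction_on with
  | C r => simp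
  | add p q hp hq =>
    rw [map_add]
    exact add_mem hp hq
  | mul_X p k hp =>
    rw [map_mul, MvPolynomial.aeval_X]
    exact mul_mem hp (hJ k)

/-- A polynomial in `I` takes equal values where all members of `I` do. -/
theorem apply_eq_of_mem_polynomialsIn (hf : f ∈ polynomialsIn I) {C D : Tensor2}
    (hC : C.PosDef) (hD : D.PosDef) (h : ∀ k, I k D = I k C) : f D = f C := by
  obtain ⟨p, hp⟩ := hf
  simp only [hp C hC, hp D hD, h]

end PolynomialsIn

/-! ### Decompositions over subalgebras -/

/-- If `x², y², z², xyz` lie in `S`, then `1, x, y, z, xy, xz, yz` span the polynomials in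
`x, y, z` as an `S`-module, because this span is stable under multiplication by `x, y, z`. -/
theorem exists_sign_decomposition {σ B : Type*} [CommRing B] [Algebra ℝ B] (S : Subalgebra ℝ B)
    {x y z : B} (hx : x ^ 2 ∈ S) (hy : y ^ 2 ∈ S) (hz : z ^ 2 ∈ S) (hxyz : x * y * z ∈ S)
    {w : σ → B} (hw : ∀ k, w k ∈ S ∨ w k = x ∨ w k = y ∨ w k = z) (p : MvPolynomial σ ℝ) :
    ∃ s₀ ∈ S, ∃ s₁ ∈ S, ∃ s₂ ∈ S, ∃ s₃ ∈ S, ∃ s₄ ∈ S, ∃ s₅ ∈ S, ∃ s₆ ∈ S,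
      MvPolynomial.aeval w p = s₀ + s₁ * x + s₂ * y + s₃ * z + s₄ * (x * y) + s₅ * (x * z) +
        s₆ * (y * z) := by
  induction p using MvPolynomial.induction_on with
  | C r =>
    refine ⟨_, S.algebraMap_mem r, 0, S.zero_mem, 0, S.zero_mem, 0, S.zero_mem, 0, S.zero_mem,
      0, S.zero_mem, 0, S.zero_mem, by simp⟩
  | add p q hp hq =>
    obtain ⟨s₀, h₀, s₁, h₁, s₂, h₂, s₃, h₃, s₄, h₄, s₅, h₅, s₆, h₆, hs⟩ := hp
    obtain ⟨t₀, k₀, t₁, k₁, t₂, k₂, t₃, k₃, t₄, k₄, t₅, k₅, t₆, k₆, ht⟩ := hq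
    refine ⟨_, add_mem h₀ k₀, _, add_mem h₁ k₁, _, add_mem h₂ k₂, _, add_mem h₃ k₃,
      _, add_mem h₄ k₄, _, add_mem h₅ k₅, _, add_mem h₆ k₆, ?_⟩
    rw [map_add, hs, ht]
    ring
  | mul_X p k hp =>
    obtain ⟨s₀, h₀, s₁, h₁, s₂, h₂, s₃, h₃, s₄, h₄, s₅, h₅, s₆, h₆, hs⟩ := hp
    rw [map_mul, MvPolynomial.aeval_X, hs]
    rcases hw k with h | h | h | h
    · refine ⟨_, mul_mem h₀ h, _, mul_mem h₁ h, _, mul_mem h₂ h, _, mul_mem h₃ h,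
        _, mul_mem h₄ h, _, mul_mem h₅ h, _, mul_mem h₆ h, ?_⟩
      ring
    · refine ⟨_, add_mem (mul_mem h₁ hx) (mul_mem h₆ hxyz), _, h₀, _, mul_mem h₄ hx,
        _, mul_mem h₅ hx, _, h₂, _, h₃, 0, S.zero_mem, ?_⟩
      rw [h]
      ring
    · refine ⟨_, add_mem (mul_mem h₂ hy) (mul_mem h₅ hxyz), _, mul_mem h₄ hy, _, h₀,
        _, mul_mem h₆ hy, _, h₁, 0, S.zero_mem, _, h₃, ?_⟩
      rw [h]
      ring
    · refine ⟨_, add_mem (mul_mem h₃ hz) (mul_mem h₄ hxyz), _, mul_mem h₅ hz,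
        _, mul_mem h₆ hz, _, h₀, 0, S.zero_mem, _, h₁, _, h₂, ?_⟩
      rw [h]
      ring

/-- If `u², v², uv` lie in `A`, then `1, u, v` span the polynomials in elements of
`A + A u + A v` as an `A`-module. -/
theorem exists_swap_decomposition {σ B : Type*} [CommRing B] [Algebra ℝ B] (A : Subalgebra ℝ B)
    {u v : B} (hu : u ^ 2 ∈ A) (hv : v ^ 2 ∈ A) (huv : u * v ∈ A) {w : σ → B}
    (hw : ∀ k, ∃ r₀ ∈ A, ∃ r₁ ∈ A, ∃ r₂ ∈ A, w k = r₀ + r₁ * u + r₂ * v)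
    (p : MvPolynomial σ ℝ) :
    ∃ t₀ ∈ A, ∃ t₁ ∈ A, ∃ t₂ ∈ A, MvPolynomial.aeval w p = t₀ + t₁ * u + t₂ * v := by
  induction p using MvPolynomial.induction_on with
  | C r => exact ⟨_, A.algebraMap_mem r, 0, A.zero_mem, 0, A.zero_mem, by simp⟩
  | add p q hp hq =>
    obtain ⟨s₀, h₀, s₁, h₁, s₂, h₂, hs⟩ := hp
    obtain ⟨t₀, k₀, t₁, k₁, t₂, k₂, ht⟩ := hq
    refine ⟨_, add_mem h₀ k₀, _, add_mem h₁ k₁, _, add_mem h₂ k₂, ?_⟩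
    rw [map_add, hs, ht]
    ring
  | mul_X p k hp =>
    obtain ⟨s₀, h₀, s₁, h₁, s₂, h₂, hs⟩ := hp
    obtain ⟨r₀, k₀, r₁, k₁, r₂, k₂, hr⟩ := hw k
    refine ⟨s₀ * r₀ + s₁ * r₁ * u ^ 2 + s₂ * r₂ * v ^ 2 + (s₁ * r₂ + s₂ * r₁) * (u * v), ?_,
      s₀ * r₁ + s₁ * r₀, ?_, s₀ * r₂ + s₂ * r₀, ?_, ?_⟩
    · exact add_mem (add_mem (add_mem (mul_mem h₀ k₀) (mul_mem (mul_mem h₁ k₁) hu))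
        (mul_mem (mul_mem h₂ k₂) hv)) (mul_mem (add_mem (mul_mem h₁ k₂) (mul_mem h₂ k₁)) huv)
    · exact add_mem (mul_mem h₀ k₁) (mul_mem h₁ k₀)
    · exact add_mem (mul_mem h₀ k₂) (mul_mem h₂ k₀)
    · rw [map_mul, MvPolynomial.aeval_X, hs, hr]
      ring

/-! ### Polyconvexity -/

/-- The square of the Euclidean norm of `A v`. -/
def normSqMulVec (v : Fin 3 → ℝ) (A : Tensor2) : ℝ := ∑ i, ((A *ᵥ v) i) ^ 2

theorem normSqMulVec_nonneg (v : Fin 3 → ℝ) (A : Tensor2) : 0 ≤ normSqMulVec v A :=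
  Finset.sum_nonneg fun _ _ => sq_nonneg _

theorem convexOn_finset_sum {ι E : Type*} [AddCommGroup E] [Module ℝ E] (s : Finset ι)
    {f : ι → E → ℝ} (hf : ∀ i, ConvexOn ℝ Set.univ (f i)) :
    ConvexOn ℝ Set.univ fun x => ∑ i ∈ s, f i x := by
  classical
  induction s using Finset.induction_on with
  | empty => simpa using convexOn_const (0 : ℝ) convex_univ
  | insert a s ha ih =>
    simp only [Finset.sum_insert ha]
    exact (hf a).add ih

theorem convexOn_normSqMulVec_comp {E : Type*} [AddCommGroup E] [Module ℝ E] (v : Fin 3 → ℝ)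
    (L : E →ₗ[ℝ] Tensor2) : ConvexOn ℝ Set.univ fun x => normSqMulVec v (L x) := by
  refine convexOn_finset_sum _ fun i => ?_
  have h := (even_two.convexOn_pow (𝕜 := ℝ)).comp_linearMap
    ((LinearMap.proj i : (Fin 3 → ℝ) →ₗ[ℝ] ℝ) ∘ₗ (Matrix.mulVecBilin ℝ ℝ).flip v ∘ₗ L)
  simpa [Function.comp_def] using h

theorem ddot_vecMulVec (v : Fin 3 → ℝ) (A : Tensor2) :
    ddot (Matrix.vecMulVec v v) A = v ⬝ᵥ A *ᵥ v := by
  simp only [ddot, Matrix.vecMulVec_apply, dotProduct, Matrix.mulVec, Finset.mul_sum]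
  exact Finset.sum_congr rfl fun i _ => Finset.sum_congr rfl fun j _ => by ring

theorem ddot_vecMulVec_transpose_mul_self (v : Fin 3 → ℝ) (A : Tensor2) :
    ddot (Matrix.vecMulVec v v) (Aᵀ * A) = normSqMulVec v A := by
  rw [ddot_vecMulVec, ← Matrix.mulVec_mulVec, Matrix.dotProduct_mulVec, Matrix.vecMul_transpose]
  simp [normSqMulVec, dotProduct, sq]

theorem cof_mul (A B : Tensor2) : cof (A * B) = cof A * cof B := by
  simp [cof, Matrix.adjugate_mul_distrib, Matrix.transpose_mul]

theorem cof_transpose (A : Tensor2) : cof Aᵀ = (cof A)ᵀ := by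
  simp [cof, Matrix.adjugate_transpose]

theorem cof_transpose_mul_self (A : Tensor2) : cof (Aᵀ * A) = (cof A)ᵀ * cof A := by
  rw [cof_mul, cof_transpose]

theorem trace_eq_sum_ddot (A : Tensor2) :
    A.trace = ∑ i, ddot (Matrix.vecMulVec (Pi.single i 1) (Pi.single i 1)) A := by
  simp [ddot_vecMulVec, Matrix.trace]

theorem isPolyconvex_Itet (n : Fin 2 → Fin 3 → ℝ) (k : Fin 5) : IsPolyconvex (Itet n k) := by
  have h₁ (i : Fin 2) :
      ConvexOn ℝ Set.univ fun x : Tensor2 × Tensor2 × ℝ => normSqMulVec (n i) x.1 :=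
    convexOn_normSqMulVec_comp (n i) (LinearMap.fst ℝ Tensor2 (Tensor2 × ℝ))
  have h₂ (i : Fin 2) :
      ConvexOn ℝ Set.univ fun x : Tensor2 × Tensor2 × ℝ => normSqMulVec (n i) x.2.1 :=
    convexOn_normSqMulVec_comp (n i)
      (LinearMap.fst ℝ Tensor2 ℝ ∘ₗ LinearMap.snd ℝ Tensor2 (Tensor2 × ℝ))
  fin_cases k
  · refine ⟨fun x => ∑ i, normSqMulVec (n i) x.1, convexOn_finset_sum _ h₁, fun F _ => ?_⟩
    simp [Itet, dyadN, ddot_vecMulVec_transpose_mul_self]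
  · refine ⟨fun x => ∑ i, normSqMulVec (n i) x.1 ^ 2, convexOn_finset_sum _ fun i =>
      (h₁ i).pow (fun _ _ => normSqMulVec_nonneg _ _) 2, fun F _ => ?_⟩
    simp [Itet, dyadN, ddot_vecMulVec_transpose_mul_self]
  · refine ⟨fun x => ∑ i, normSqMulVec (n i) x.2.1, convexOn_finset_sum _ h₂, fun F _ => ?_⟩
    simp [Itet, dyadN, cof_transpose_mul_self, ddot_vecMulVec_transpose_mul_self]
  · refine ⟨fun x => ∑ i, normSqMulVec (n i) x.2.1 ^ 2, convexOn_finset_sum _ fun i =>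
      (h₂ i).pow (fun _ _ => normSqMulVec_nonneg _ _) 2, fun F _ => ?_⟩
    simp [Itet, dyadN, cof_transpose_mul_self, ddot_vecMulVec_transpose_mul_self]
  · refine ⟨fun x => ∑ i, (normSqMulVec (n i) x.1 + normSqMulVec (n i) x.2.1) ^ 2,
      convexOn_finset_sum _ fun i => ((h₁ i).add (h₂ i)).pow
        (fun _ _ => add_nonneg (normSqMulVec_nonneg _ _) (normSqMulVec_nonneg _ _)) 2,
      fun F _ => ?_⟩
    simp [Itet, dyadN, cof_transpose_mul_self, ddot_vecMulVec_transpose_mul_self]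

theorem isPolyconvex_Iiso (k : Fin 3) : IsPolyconvex (Iiso k) := by
  fin_cases k
  · refine ⟨fun x => ∑ i : Fin 3, normSqMulVec (Pi.single i 1) x.1,
      convexOn_finset_sum _ fun i => convexOn_normSqMulVec_comp
        (Pi.single i 1) (LinearMap.fst ℝ Tensor2 (Tensor2 × ℝ)), fun F _ => ?_⟩
    simp only [← ddot_vecMulVec_transpose_mul_self, ← trace_eq_sum_ddot]
    rfl
  · refine ⟨fun x => ∑ i : Fin 3, normSqMulVec (Pi.single i 1) x.2.1,
      convexOn_finset_sum _ fun i => convexOn_normSqMulVec_comp (Pi.single i 1)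
        (LinearMap.fst ℝ Tensor2 ℝ ∘ₗ LinearMap.snd ℝ Tensor2 (Tensor2 × ℝ)), fun F _ => ?_⟩
    simp only [← ddot_vecMulVec_transpose_mul_self, ← trace_eq_sum_ddot,
      ← cof_transpose_mul_self]
    rfl
  · refine ⟨fun x => x.2.2 ^ 2, (even_two.convexOn_pow (𝕜 := ℝ)).comp_linearMap
      (LinearMap.snd ℝ Tensor2 ℝ ∘ₗ LinearMap.snd ℝ Tensor2 (Tensor2 × ℝ)), fun F _ => ?_⟩
    simp [Iiso, sq]

/-! ### Coordinates in the frame of the preferred directions -/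

/-- The matrix with rows `n⁽¹⁾, n⁽²⁾, n⁽¹⁾ × n⁽²⁾`. -/
def frame (n : Fin 2 → Fin 3 → ℝ) : Tensor2 :=
  Matrix.of ![n 0, n 1, crossProduct (n 0) (n 1)]

/-- The components of `C` with respect to the frame `n⁽¹⁾, n⁽²⁾, n⁽¹⁾ × n⁽²⁾`. -/
def inFrame (n : Fin 2 → Fin 3 → ℝ) (C : Tensor2) : Tensor2 := frame n * C * (frame n)ᵀ

/-- The six independent components of a symmetric tensor in the frame of `n`, in the order
`11, 22, 33, 12, 13, 23`. -/
def frameCoord (n : Fin 2 → Fin 3 → ℝ) : Fin 6 → Tensor2 → ℝ :=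
  ![fun C => inFrame n C 0 0, fun C => inFrame n C 1 1, fun C => inFrame n C 2 2,
    fun C => inFrame n C 0 1, fun C => inFrame n C 0 2, fun C => inFrame n C 1 2]

section Frame

variable {n : Fin 2 → Fin 3 → ℝ}

theorem frame_mul_transpose (hn : ∀ i j, n i ⬝ᵥ n j = if i = j then 1 else 0) :
    frame n * (frame n)ᵀ = 1 := by
  have h00 : n 0 ⬝ᵥ n 0 = 1 := by simpa using hn 0 0
  have h01 : n 0 ⬝ᵥ n 1 = 0 := by simpa using hn 0 1
  have h10 : n 1 ⬝ᵥ n 0 = 0 := by simpa using hn 1 0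
  have h11 : n 1 ⬝ᵥ n 1 = 1 := by simpa using hn 1 1
  have h22 : crossProduct (n 0) (n 1) ⬝ᵥ crossProduct (n 0) (n 1) = 1 := by
    rw [cross_dot_cross, h00, h01, h11, h10]
    norm_num
  have h02 := dot_self_cross (n 0) (n 1)
  have h12 := dot_cross_self (n 0) (n 1)
  have h (i j : Fin 3) : (frame n * (frame n)ᵀ) i j = frame n i ⬝ᵥ frame n j := rfl
  have r0 : frame n 0 = n 0 := rfl
  have r1 : frame n 1 = n 1 := rfl
  have r2 : frame n 2 = crossProduct (n 0) (n 1) := rfl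
  ext i j
  rw [h]
  fin_cases i <;> fin_cases j <;>
    simp [r0, r1, r2, h00, h01, h10, h11, h02, h12, h22, dotProduct_comm _ (n _)]

theorem frame_transpose_mul (hn : ∀ i j, n i ⬝ᵥ n j = if i = j then 1 else 0) :
    (frame n)ᵀ * frame n = 1 :=
  mul_eq_one_comm.mp (frame_mul_transpose hn)

theorem det_frame (hn : ∀ i j, n i ⬝ᵥ n j = if i = j then 1 else 0) : (frame n).det = 1 := by
  have h : (frame n).det = n 0 ⬝ᵥ crossProduct (n 1) (crossProduct (n 0) (n 1)) :=
    (triple_product_eq_det _ _ _).symm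
  rw [h, triple_product_permutation, triple_product_permutation, cross_dot_cross, hn, hn, hn, hn]
  norm_num

theorem cof_eq_self_of_orthogonal {Q : Tensor2} (h : Q * Qᵀ = 1) (hdet : Q.det = 1) :
    cof Q = Q := by
  have hne : Q.det ≠ 0 := by simp [hdet]
  rw [cof_eq_det_smul Q hne, hdet, one_smul, Matrix.inv_eq_right_inv h, Matrix.transpose_transpose]

theorem cof_conj {Q : Tensor2} (h : Q * Qᵀ = 1) (hdet : Q.det = 1) (C : Tensor2) :
    cof (Q * C * Qᵀ) = Q * cof C * Qᵀ := by
  rw [cof_mul, cof_mul, cof_transpose, cof_eq_self_of_orthogonal h hdet]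

theorem trace_conj {Q : Tensor2} (h : Qᵀ * Q = 1) (C : Tensor2) :
    (Q * C * Qᵀ).trace = C.trace := by
  rw [Matrix.trace_mul_comm, ← mul_assoc, h, one_mul]

theorem det_conj {Q : Tensor2} (hdet : Q.det = 1) (C : Tensor2) :
    (Q * C * Qᵀ).det = C.det := by
  simp [hdet]

theorem inFrame_mul (hn : ∀ i j, n i ⬝ᵥ n j = if i = j then 1 else 0) (A B : Tensor2) :
    inFrame n (A * B) = inFrame n A * inFrame n B := by
  have h : frame n * A * (frame n)ᵀ * (frame n * B * (frame n)ᵀ) =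
      frame n * A * ((frame n)ᵀ * frame n) * B * (frame n)ᵀ := by simp only [mul_assoc]
  rw [inFrame, inFrame, inFrame, h, frame_transpose_mul hn, mul_one]
  simp only [mul_assoc]

theorem inFrame_sq (hn : ∀ i j, n i ⬝ᵥ n j = if i = j then 1 else 0) (A : Tensor2) :
    inFrame n (A ^ 2) = inFrame n A * inFrame n A := by
  rw [sq, inFrame_mul hn]

theorem cof_inFrame (hn : ∀ i j, n i ⬝ᵥ n j = if i = j then 1 else 0) (C : Tensor2) :
    inFrame n (cof C) = cof (inFrame n C) :=
  (cof_conj (frame_mul_transpose hn) (det_frame hn) C).symm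

theorem trace_inFrame (hn : ∀ i j, n i ⬝ᵥ n j = if i = j then 1 else 0) (C : Tensor2) :
    (inFrame n C).trace = C.trace :=
  trace_conj (frame_transpose_mul hn) C

theorem det_inFrame (hn : ∀ i j, n i ⬝ᵥ n j = if i = j then 1 else 0) (C : Tensor2) :
    (inFrame n C).det = C.det :=
  det_conj (det_frame hn) C

theorem eq_of_inFrame (hn : ∀ i j, n i ⬝ᵥ n j = if i = j then 1 else 0) (C : Tensor2) :
    (frame n)ᵀ * inFrame n C * frame n = C := by
  have h : (frame n)ᵀ * (frame n * C * (frame n)ᵀ) * frame n =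
      ((frame n)ᵀ * frame n) * C * ((frame n)ᵀ * frame n) := by simp only [mul_assoc]
  rw [inFrame, h, frame_transpose_mul hn, one_mul, mul_one]

theorem inFrame_symm {C : Tensor2} (hC : C.PosDef) (i j : Fin 3) :
    inFrame n C j i = inFrame n C i j := by
  have h : Cᵀ = C := by simpa using hC.isHermitian.eq
  have h' : (inFrame n C)ᵀ = inFrame n C := by
    simp [inFrame, Matrix.transpose_mul, h, mul_assoc]
  exact congrFun (congrFun h' i) j

theorem inFrame_apply (C : Tensor2) (i j : Fin 3) :
    inFrame n C i j = frame n i ⬝ᵥ C *ᵥ frame n j := by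
  simp only [inFrame, Matrix.mul_apply, dotProduct, Matrix.mulVec, Matrix.transpose_apply,
    Finset.mul_sum, Finset.sum_mul]
  rw [Finset.sum_comm]
  exact Finset.sum_congr rfl fun _ _ => Finset.sum_congr rfl fun _ _ => by ring

theorem ddot_dyadN (C : Tensor2) (i : Fin 2) :
    ddot (dyadN n i) C = inFrame n C i.castSucc i.castSucc := by
  rw [dyadN, ddot_vecMulVec, inFrame_apply]
  fin_cases i <;> rfl

/-- In the frame of `n`, the contraction with `𝕄` keeps the diagonal entries `11` and `22` and
deletes all others. -/
theorem inFrame_contract (hn : ∀ i j, n i ⬝ᵥ n j = if i = j then 1 else 0) (A : Tensor2) :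
    inFrame n (contract (structTensor n) A) =
      Matrix.diagonal ![inFrame n A 0 0, inFrame n A 1 1, 0] := by
  have h : contract (structTensor n) A =
      (frame n)ᵀ * Matrix.diagonal ![inFrame n A 0 0, inFrame n A 1 1, 0] * frame n := by
    have h0 := ddot_dyadN (n := n) A 0
    have h1 := ddot_dyadN (n := n) A 1
    simp only [Fin.castSucc_zero, Fin.castSucc_one] at h0 h1
    rw [← h0, ← h1]
    ext i j
    simp only [contract, structTensor, ddot, dyadN, Matrix.vecMulVec_apply, Matrix.of_apply,
      Matrix.mul_apply, Matrix.diagonal_apply, Matrix.transpose_apply, frame,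
      Fin.sum_univ_three, Fin.sum_univ_two]
    simp
    ring
  have h' (D : Tensor2) : frame n * ((frame n)ᵀ * D * frame n) * (frame n)ᵀ =
      (frame n * (frame n)ᵀ) * D * (frame n * (frame n)ᵀ) := by simp only [mul_assoc]
  rw [inFrame, h, h', frame_mul_transpose hn, one_mul, mul_one]

end Frame

/-! ### The invariants in coordinates -/

theorem cof_apply_zero_zero (B : Tensor2) : cof B 0 0 = B 1 1 * B 2 2 - B 1 2 * B 2 1 := by
  simp [cof, Matrix.adjugate_fin_three]

theorem cof_apply_one_one (B : Tensor2) : cof B 1 1 = B 0 0 * B 2 2 - B 0 2 * B 2 0 := by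
  simp [cof, Matrix.adjugate_fin_three]

theorem cof_apply_two_two (B : Tensor2) : cof B 2 2 = B 0 0 * B 1 1 - B 0 1 * B 1 0 := by
  simp [cof, Matrix.adjugate_fin_three]

section Coordinates

variable {n : Fin 2 → Fin 3 → ℝ}

theorem Itet_apply (hn : ∀ i j, n i ⬝ᵥ n j = if i = j then 1 else 0) {C : Tensor2}
    (hC : C.PosDef) {a b c d e f : ℝ} (h : ∀ k, frameCoord n k C = ![a, b, c, d, e, f] k)
    (k : Fin 5) :
    Itet n k C = ![a + b, a ^ 2 + b ^ 2, (b * c - f ^ 2) + (a * c - e ^ 2),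
      (b * c - f ^ 2) ^ 2 + (a * c - e ^ 2) ^ 2,
      (a + (b * c - f ^ 2)) ^ 2 + (b + (a * c - e ^ 2)) ^ 2] k := by
  have h0 : inFrame n C 0 0 = a := h 0
  have h1 : inFrame n C 1 1 = b := h 1
  have h2 : inFrame n C 2 2 = c := h 2
  have h4 : inFrame n C 0 2 = e := h 4
  have h5 : inFrame n C 1 2 = f := h 5
  fin_cases k <;>
    simp [Itet, ddot_dyadN, cof_inFrame hn, cof_apply_zero_zero, cof_apply_one_one,
      inFrame_symm hC 0 2, inFrame_symm hC 1 2, h0, h1, h2, h4, h5] <;> ring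

theorem Iiso_apply (hn : ∀ i j, n i ⬝ᵥ n j = if i = j then 1 else 0) {C : Tensor2}
    (hC : C.PosDef) {a b c d e f : ℝ} (h : ∀ k, frameCoord n k C = ![a, b, c, d, e, f] k)
    (k : Fin 3) :
    Iiso k C = ![a + b + c, (b * c - f ^ 2) + (a * c - e ^ 2) + (a * b - d ^ 2),
      a * b * c + 2 * (d * e * f) - a * f ^ 2 - b * e ^ 2 - c * d ^ 2] k := by
  have h0 : inFrame n C 0 0 = a := h 0
  have h1 : inFrame n C 1 1 = b := h 1
  have h2 : inFrame n C 2 2 = c := h 2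
  have h3 : inFrame n C 0 1 = d := h 3
  have h4 : inFrame n C 0 2 = e := h 4
  have h5 : inFrame n C 1 2 = f := h 5
  have hI : Iiso k C = ![(inFrame n C).trace, (cof (inFrame n C)).trace, (inFrame n C).det] k := by
    rw [← cof_inFrame hn, det_inFrame hn]
    simp only [trace_inFrame hn]
    fin_cases k <;> rfl
  rw [hI]
  fin_cases k <;>
    simp [Matrix.det_fin_three, Matrix.trace_fin_three,
      cof_apply_zero_zero, cof_apply_one_one, cof_apply_two_two,
      inFrame_symm hC 0 1, inFrame_symm hC 0 2, inFrame_symm hC 1 2, h0, h1, h2, h3, h4, h5] <;>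
    ring

theorem Jtet_apply (hn : ∀ i j, n i ⬝ᵥ n j = if i = j then 1 else 0) {C : Tensor2}
    (hC : C.PosDef) {a b c d e f : ℝ} (h : ∀ k, frameCoord n k C = ![a, b, c, d, e, f] k)
    (k : Fin 5) :
    Jtet n k C = ![a + b, a ^ 2 + b ^ 2,
      (a ^ 2 + d ^ 2 + e ^ 2) + (d ^ 2 + b ^ 2 + f ^ 2),
      (a ^ 2 + d ^ 2 + e ^ 2) * a + (d ^ 2 + b ^ 2 + f ^ 2) * b,
      (a ^ 2 + d ^ 2 + e ^ 2) ^ 2 + (d ^ 2 + b ^ 2 + f ^ 2) ^ 2] k := by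
  have h0 : inFrame n C 0 0 = a := h 0
  have h1 : inFrame n C 1 1 = b := h 1
  have h2 : inFrame n C 2 2 = c := h 2
  have h3 : inFrame n C 0 1 = d := h 3
  have h4 : inFrame n C 0 2 = e := h 4
  have h5 : inFrame n C 1 2 = f := h 5
  have hJ : Jtet n k C = ![(inFrame n (contract (structTensor n) C)).trace,
      (inFrame n (contract (structTensor n) C ^ 2)).trace,
      (inFrame n (contract (structTensor n) (C ^ 2))).trace,
      (inFrame n (C ^ 2 * contract (structTensor n) C)).trace,
      (inFrame n (contract (structTensor n) (C ^ 2) ^ 2)).trace] k := by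
    simp only [trace_inFrame hn]
    fin_cases k <;> rfl
  rw [hJ]
  fin_cases k <;>
    simp [inFrame_mul hn, inFrame_sq hn, inFrame_contract hn, Matrix.trace_fin_three,
      Matrix.mul_apply, Fin.sum_univ_three, Matrix.diagonal_apply,
      inFrame_symm hC 0 1, inFrame_symm hC 0 2, inFrame_symm hC 1 2, h0, h1, h2, h3, h4, h5] <;>
    ring

theorem Jiso_apply (hn : ∀ i j, n i ⬝ᵥ n j = if i = j then 1 else 0) {C : Tensor2}
    (hC : C.PosDef) {a b c d e f : ℝ} (h : ∀ k, frameCoord n k C = ![a, b, c, d, e, f] k)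
    (k : Fin 2) :
    Jiso k.castSucc C =
      ![a + b + c, a ^ 2 + b ^ 2 + c ^ 2 + 2 * (d ^ 2 + e ^ 2 + f ^ 2)] k := by
  have h0 : inFrame n C 0 0 = a := h 0
  have h1 : inFrame n C 1 1 = b := h 1
  have h2 : inFrame n C 2 2 = c := h 2
  have h3 : inFrame n C 0 1 = d := h 3
  have h4 : inFrame n C 0 2 = e := h 4
  have h5 : inFrame n C 1 2 = f := h 5
  have hJ : Jiso k.castSucc C =
      ![(inFrame n C).trace, (inFrame n C * inFrame n C).trace] k := by
    rw [← inFrame_sq hn]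
    simp only [trace_inFrame hn]
    fin_cases k <;> rfl
  rw [hJ]
  fin_cases k <;>
    simp [Matrix.trace_fin_three, Matrix.mul_apply, Fin.sum_univ_three,
      inFrame_symm hC 0 1, inFrame_symm hC 0 2, inFrame_symm hC 1 2, h0, h1, h2, h3, h4, h5]
  ring

end Coordinates

/-! ### Newton's identities for the isotropic invariants -/

theorem isPolynomialIn_Iiso_Jiso (k : Fin 3) : IsPolynomialIn Iiso (Jiso k) := by
  open MvPolynomial in
  fin_cases k
  · exact ⟨X 0, fun C _ => by simp [Iiso, Jiso]⟩
  · refine ⟨X 0 ^ 2 - C 2 * X 1, fun A _ => ?_⟩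
    simp [Iiso, Jiso, sq, Matrix.trace_fin_three, Matrix.mul_apply, Fin.sum_univ_three,
      cof_apply_zero_zero, cof_apply_one_one, cof_apply_two_two]
    ring
  · refine ⟨X 0 ^ 3 - C 3 * X 0 * X 1 + C 3 * X 2, fun A _ => ?_⟩
    simp [Iiso, Jiso, pow_succ, Matrix.trace_fin_three, Matrix.mul_apply, Fin.sum_univ_three,
      cof_apply_zero_zero, cof_apply_one_one, cof_apply_two_two, Matrix.det_fin_three]
    ring

theorem isPolynomialIn_Jiso_Iiso (k : Fin 3) : IsPolynomialIn Jiso (Iiso k) := by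
  open MvPolynomial in
  fin_cases k
  · exact ⟨X 0, fun C _ => by simp [Iiso, Jiso]⟩
  · refine ⟨C (1 / 2) * (X 0 ^ 2 - X 1), fun A _ => ?_⟩
    simp [Iiso, Jiso, sq, Matrix.trace_fin_three, Matrix.mul_apply, Fin.sum_univ_three,
      cof_apply_zero_zero, cof_apply_one_one, cof_apply_two_two]
    ring
  · refine ⟨C (1 / 6) * (X 0 ^ 3 - C 3 * X 0 * X 1 + C 2 * X 2), fun A _ => ?_⟩
    simp [Iiso, Jiso, pow_succ, Matrix.trace_fin_three, Matrix.mul_apply, Fin.sum_univ_three,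
      Matrix.det_fin_three]
    ring

/-! ### Components with respect to the frame as polynomial functions -/

section Entries

variable {ι : Type} {I : ι → Tensor2 → ℝ}

theorem mul_mul_entry_mem_polynomialsIn {M : Tensor2 → Tensor2}
    (hM : ∀ i j, (fun C => M C i j) ∈ polynomialsIn I) (A B : Tensor2) (i j : Fin 3) :
    (fun C => (A * M C * B) i j) ∈ polynomialsIn I := by
  have h : (fun C => (A * M C * B) i j) = ∑ l, ∑ k, (A i k * B l j) • fun C => M C k l := by
    ext C
    simp only [Matrix.mul_apply, Finset.sum_mul, Finset.sum_apply, Pi.smul_apply, smul_eq_mul]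
    exact Finset.sum_congr rfl fun _ _ => Finset.sum_congr rfl fun _ _ => by ring
  rw [h]
  exact sum_mem fun l _ => sum_mem fun k _ => Subalgebra.smul_mem _ (hM k l) _

theorem frameCoord_mem_entries (n : Fin 2 → Fin 3 → ℝ) (k : Fin 6) :
    frameCoord n k ∈ polynomialsIn fun (ij : Fin 3 × Fin 3) (C : Tensor2) => C ij.1 ij.2 := by
  have h (i j : Fin 3) := mul_mul_entry_mem_polynomialsIn (M := fun C => C)
    (fun i j => self_mem_polynomialsIn
      (fun (ij : Fin 3 × Fin 3) (C : Tensor2) => C ij.1 ij.2) (i, j)) (frame n) (frame n)ᵀ i j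
  fin_cases k
  exacts [h 0 0, h 1 1, h 2 2, h 0 1, h 0 2, h 1 2]

theorem entry_mem_frameCoord {n : Fin 2 → Fin 3 → ℝ}
    (hn : ∀ i j, n i ⬝ᵥ n j = if i = j then 1 else 0) (i j : Fin 3) :
    (fun C => C i j) ∈ polynomialsIn (frameCoord n) := by
  have h := self_mem_polynomialsIn (frameCoord n)
  have hB (i j : Fin 3) : (fun C => inFrame n C i j) ∈ polynomialsIn (frameCoord n) := by
    fin_cases i <;> fin_cases j
    · exact h 0
    · exact h 3
    · exact h 4
    · exact mem_polynomialsIn_of_eq (h 3) fun C hC => inFrame_symm hC 0 1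
    · exact h 1
    · exact h 5
    · exact mem_polynomialsIn_of_eq (h 4) fun C hC => inFrame_symm hC 0 2
    · exact mem_polynomialsIn_of_eq (h 5) fun C hC => inFrame_symm hC 1 2
    · exact h 2
  refine mem_polynomialsIn_of_eq
    (mul_mul_entry_mem_polynomialsIn (M := inFrame n) hB (frame n)ᵀ (frame n) i j) fun C _ => ?_
  rw [eq_of_inFrame hn]

end Entries

/-! ### Elementary invariants -/

/-- With `a, b, c, d, e, f` the components `11, 22, 33, 12, 13, 23` of `C` in the frame of `n`,
the seven functions `a + b, a b, c, d², e² + f², a e² + b f², e² f²`. Together with `d e f` they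
generate the invariants of `D₄`. -/
def tetInvariant (n : Fin 2 → Fin 3 → ℝ) : Fin 7 → Tensor2 → ℝ :=
  ![frameCoord n 0 + frameCoord n 1, frameCoord n 0 * frameCoord n 1, frameCoord n 2,
    frameCoord n 3 ^ 2, frameCoord n 4 ^ 2 + frameCoord n 5 ^ 2,
    frameCoord n 0 * frameCoord n 4 ^ 2 + frameCoord n 1 * frameCoord n 5 ^ 2,
    frameCoord n 4 ^ 2 * frameCoord n 5 ^ 2]

section Elementary

variable {n : Fin 2 → Fin 3 → ℝ}

theorem frameCoord_eta (n : Fin 2 → Fin 3 → ℝ) (C : Tensor2) (k : Fin 6) :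
    frameCoord n k C = ![frameCoord n 0 C, frameCoord n 1 C, frameCoord n 2 C, frameCoord n 3 C,
      frameCoord n 4 C, frameCoord n 5 C] k := by
  fin_cases k <;> rfl

theorem Itet_mem_tetInvariant (hn : ∀ i j, n i ⬝ᵥ n j = if i = j then 1 else 0) (k : Fin 5) :
    Itet n k ∈ polynomialsIn (tetInvariant n) := by
  open MvPolynomial in
  refine ⟨![X 0, X 0 ^ 2 - C 2 * X 1, X 0 * X 2 - X 4,
    (X 0 ^ 2 - C 2 * X 1) * X 2 ^ 2 - C 2 * X 2 * X 5 + X 4 ^ 2 - C 2 * X 6,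
    (X 0 ^ 2 - C 2 * X 1) + ((X 0 ^ 2 - C 2 * X 1) * X 2 ^ 2 - C 2 * X 2 * X 5 + X 4 ^ 2 -
      C 2 * X 6) + C 2 * (C 2 * X 1 * X 2 - X 0 * X 4 + X 5)] k, fun A hA => ?_⟩
  rw [Itet_apply hn hA (frameCoord_eta n A)]
  fin_cases k <;> simp [tetInvariant] <;> ring

theorem Iiso_mem_tetInvariant (hn : ∀ i j, n i ⬝ᵥ n j = if i = j then 1 else 0) (k : Fin 2) :
    Iiso k.castSucc ∈ polynomialsIn (tetInvariant n) := by
  open MvPolynomial in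
  refine ⟨![X 0 + X 2, X 0 * X 2 - X 4 + X 1 - X 3] k, fun A hA => ?_⟩
  rw [Iiso_apply hn hA (frameCoord_eta n A)]
  fin_cases k <;> simp [tetInvariant]
  ring

theorem Jtet_mem_tetInvariant (hn : ∀ i j, n i ⬝ᵥ n j = if i = j then 1 else 0) (k : Fin 5) :
    Jtet n k ∈ polynomialsIn (tetInvariant n) := by
  open MvPolynomial in
  refine ⟨![X 0, X 0 ^ 2 - C 2 * X 1, X 0 ^ 2 - C 2 * X 1 + C 2 * X 3 + X 4,
    X 0 * (X 0 ^ 2 - C 3 * X 1) + X 0 * X 3 + X 5,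
    (X 0 ^ 2 - C 2 * X 1) ^ 2 - C 2 * X 1 ^ 2 + C 2 * X 3 ^ 2 + X 4 ^ 2 - C 2 * X 6 +
      C 2 * (X 0 ^ 2 - C 2 * X 1) * X 3 + C 2 * (X 0 * X 5 - X 1 * X 4) + C 2 * X 3 * X 4] k,
    fun A hA => ?_⟩
  rw [Jtet_apply hn hA (frameCoord_eta n A)]
  fin_cases k <;> simp [tetInvariant] <;> ring

theorem Jiso_mem_tetInvariant (hn : ∀ i j, n i ⬝ᵥ n j = if i = j then 1 else 0) (k : Fin 2) :
    Jiso k.castSucc ∈ polynomialsIn (tetInvariant n) := by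
  open MvPolynomial in
  refine ⟨![X 0 + X 2, X 0 ^ 2 - C 2 * X 1 + X 2 ^ 2 + C 2 * (X 3 + X 4)] k, fun A hA => ?_⟩
  rw [Jiso_apply hn hA (frameCoord_eta n A)]
  fin_cases k <;> simp [tetInvariant]
  ring

variable {ι : Type} {I : ι → Tensor2 → ℝ}

/-- The seven elementary invariants can be solved for one after the other from the `I`-tuple
without `det C`. -/
theorem tetInvariant_mem_of_Itet (hn : ∀ i j, n i ⬝ᵥ n j = if i = j then 1 else 0)
    (hI : ∀ k, Itet n k ∈ polynomialsIn I) (hI' : ∀ k : Fin 2, Iiso k.castSucc ∈ polynomialsIn I)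
    (k : Fin 7) : tetInvariant n k ∈ polynomialsIn I := by
  have F (C : Tensor2) (hC : C.PosDef) := Itet_apply hn hC (frameCoord_eta n C)
  have F' (C : Tensor2) (hC : C.PosDef) := Iiso_apply hn hC (frameCoord_eta n C)
  have e0 : tetInvariant n 0 ∈ polynomialsIn I :=
    mem_polynomialsIn_of_eq (hI 0) fun C hC => by simp [F C hC, tetInvariant]
  have e1 : tetInvariant n 1 ∈ polynomialsIn I :=
    mem_polynomialsIn_of_eq (Subalgebra.smul_mem _ (sub_mem (pow_mem e0 2) (hI 1)) (1 / 2))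
      fun C hC => by simp [F C hC, tetInvariant]; ring
  have e2 : tetInvariant n 2 ∈ polynomialsIn I :=
    mem_polynomialsIn_of_eq (sub_mem (hI' 0) e0) fun C hC => by simp [F' C hC, tetInvariant]
  have e4 : tetInvariant n 4 ∈ polynomialsIn I :=
    mem_polynomialsIn_of_eq (sub_mem (mul_mem e0 e2) (hI 2)) fun C hC => by
      simp [F C hC, tetInvariant]; ring
  have e3 : tetInvariant n 3 ∈ polynomialsIn I :=
    mem_polynomialsIn_of_eq (add_mem (sub_mem e1 (hI' 1)) (hI 2)) fun C hC => by
      simp [F C hC, F' C hC, tetInvariant]; ring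
  -- `I₅ - I₂ - I₄` is twice `2 a b c - (a f² + b e²)`, where `a f² + b e²` is the difference of
  -- `(a + b) (e² + f²)` and `a e² + b f²`
  have e5 : tetInvariant n 5 ∈ polynomialsIn I :=
    mem_polynomialsIn_of_eq (add_mem (sub_mem
      (Subalgebra.smul_mem _ (sub_mem (sub_mem (hI 4) (hI 1)) (hI 3)) (1 / 2))
      (Subalgebra.smul_mem _ (mul_mem e1 e2) 2)) (mul_mem e0 e4)) fun C hC => by
      simp [F C hC, tetInvariant]; ring
  have e6 : tetInvariant n 6 ∈ polynomialsIn I :=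
    mem_polynomialsIn_of_eq (Subalgebra.smul_mem _ (sub_mem (add_mem (sub_mem
      (mul_mem (hI 1) (pow_mem e2 2)) (Subalgebra.smul_mem _ (mul_mem e2 e5) 2))
      (pow_mem e4 2)) (hI 3)) (1 / 2)) fun C hC => by
      simp [F C hC, tetInvariant]; ring
  fin_cases k
  exacts [e0, e1, e2, e3, e4, e5, e6]

/-- The seven elementary invariants can be solved for one after the other from the `J`-tuple
without `tr C³`. -/
theorem tetInvariant_mem_of_Jtet (hn : ∀ i j, n i ⬝ᵥ n j = if i = j then 1 else 0)
    (hJ : ∀ k, Jtet n k ∈ polynomialsIn I) (hJ' : ∀ k : Fin 2, Jiso k.castSucc ∈ polynomialsIn I)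
    (k : Fin 7) : tetInvariant n k ∈ polynomialsIn I := by
  have F (C : Tensor2) (hC : C.PosDef) := Jtet_apply hn hC (frameCoord_eta n C)
  have F0 (C : Tensor2) (hC : C.PosDef) := Jiso_apply hn hC (frameCoord_eta n C) 0
  have F1 (C : Tensor2) (hC : C.PosDef) := Jiso_apply hn hC (frameCoord_eta n C) 1
  simp only [Fin.castSucc_zero, Fin.castSucc_one] at F0 F1
  have e0 : tetInvariant n 0 ∈ polynomialsIn I :=
    mem_polynomialsIn_of_eq (hJ 0) fun C hC => by simp [F C hC, tetInvariant]
  have e1 : tetInvariant n 1 ∈ polynomialsIn I :=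
    mem_polynomialsIn_of_eq (Subalgebra.smul_mem _ (sub_mem (pow_mem e0 2) (hJ 1)) (1 / 2))
      fun C hC => by simp [F C hC, tetInvariant]; ring
  have e2 : tetInvariant n 2 ∈ polynomialsIn I :=
    mem_polynomialsIn_of_eq (sub_mem (hJ' 0) e0) fun C hC => by simp [F0 C hC, tetInvariant]
  -- `2 d² + (e² + f²)` and `d² + (e² + f²)` determine `d²` and `e² + f²`
  have x : Jtet n 2 - Jtet n 1 ∈ polynomialsIn I := sub_mem (hJ 2) (hJ 1)
  have y : (1 / 2 : ℝ) • (Jiso 1 - Jtet n 1 - tetInvariant n 2 ^ 2) ∈ polynomialsIn I :=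
    Subalgebra.smul_mem _ (sub_mem (sub_mem (hJ' 1) (hJ 1)) (pow_mem e2 2)) _
  have e3 : tetInvariant n 3 ∈ polynomialsIn I :=
    mem_polynomialsIn_of_eq (sub_mem x y) fun C hC => by
      simp [F C hC, F1 C hC, tetInvariant]; ring
  have e4 : tetInvariant n 4 ∈ polynomialsIn I :=
    mem_polynomialsIn_of_eq (sub_mem (Subalgebra.smul_mem _ y 2) x) fun C hC => by
      simp [F C hC, F1 C hC, tetInvariant]; ring
  have e5 : tetInvariant n 5 ∈ polynomialsIn I :=
    mem_polynomialsIn_of_eq (sub_mem (sub_mem (hJ 3) (mul_mem e0 (sub_mem (hJ 1) e1)))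
      (mul_mem e0 e3)) fun C hC => by
      simp [F C hC, tetInvariant]; ring
  -- `a² e² + b² f²` equals `(a + b) (a e² + b f²) - a b (e² + f²)`
  have z : tetInvariant n 0 * tetInvariant n 5 - tetInvariant n 1 * tetInvariant n 4 ∈
      polynomialsIn I := sub_mem (mul_mem e0 e5) (mul_mem e1 e4)
  have e6 : tetInvariant n 6 ∈ polynomialsIn I := by
    refine mem_polynomialsIn_of_eq
      (g := (1 / 2 : ℝ) • (Jtet n 1 ^ 2 + tetInvariant n 4 ^ 2 - Jtet n 4) -
        tetInvariant n 1 ^ 2 + tetInvariant n 3 ^ 2 + Jtet n 1 * tetInvariant n 3 +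
        (tetInvariant n 0 * tetInvariant n 5 - tetInvariant n 1 * tetInvariant n 4) +
        tetInvariant n 3 * tetInvariant n 4)
      (add_mem (add_mem (add_mem (add_mem (sub_mem (Subalgebra.smul_mem _ (sub_mem (add_mem
        (pow_mem (hJ 1) 2) (pow_mem e4 2)) (hJ 4)) _) (pow_mem e1 2)) (pow_mem e3 2))
        (mul_mem (hJ 1) e3)) z) (mul_mem e3 e4)) fun C hC => ?_
    simp [F C hC, tetInvariant]
    ring
  fin_cases k
  exacts [e0, e1, e2, e3, e4, e5, e6]

/-- The product of the three shear components is recovered from `det C`. -/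
theorem shear_product_mem (hn : ∀ i j, n i ⬝ᵥ n j = if i = j then 1 else 0)
    (hI : ∀ k, tetInvariant n k ∈ polynomialsIn I) (hdet : Iiso 2 ∈ polynomialsIn I) :
    frameCoord n 3 * frameCoord n 4 * frameCoord n 5 ∈ polynomialsIn I := by
  refine mem_polynomialsIn_of_eq (Subalgebra.smul_mem _ (add_mem (add_mem (sub_mem hdet
    (mul_mem (hI 1) (hI 2))) (sub_mem (mul_mem (hI 0) (hI 4)) (hI 5)))
    (mul_mem (hI 2) (hI 3))) (1 / 2)) fun C hC => ?_
  simp [Iiso_apply hn hC (frameCoord_eta n C), tetInvariant]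
  ring

end Elementary

/-! ### The action of the tetragonal group -/

section Action

variable {n : Fin 2 → Fin 3 → ℝ}

theorem mul_transpose_of_mem_SO (Q : Matrix.specialOrthogonalGroup (Fin 3) ℝ) :
    (Q : Tensor2) * (Q : Tensor2)ᵀ = 1 :=
  (Matrix.mem_orthogonalGroup_iff _ _).mp (Matrix.mem_specialOrthogonalGroup_iff.mp Q.2).1

theorem det_of_mem_SO (Q : Matrix.specialOrthogonalGroup (Fin 3) ℝ) : (Q : Tensor2).det = 1 :=
  (Matrix.mem_specialOrthogonalGroup_iff.mp Q.2).2

theorem posDef_conj (Q : Matrix.specialOrthogonalGroup (Fin 3) ℝ) {C : Tensor2} (hC : C.PosDef) :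
    ((Q : Tensor2) * C * (Q : Tensor2)ᵀ).PosDef := by
  have h := hC.mul_mul_conjTranspose_same (B := (Q : Tensor2)) fun v w hvw => by
    simpa [Matrix.vecMul_vecMul, mul_transpose_of_mem_SO] using
      congrArg (fun u => u ᵥ* (Q : Tensor2)ᵀ) hvw
  simpa using h

theorem ddot_dyadN_conj (Q C : Tensor2) (i : Fin 2) :
    ddot (dyadN n i) (Q * C * Qᵀ) = (Qᵀ *ᵥ n i) ⬝ᵥ C *ᵥ (Qᵀ *ᵥ n i) := by
  rw [dyadN, ddot_vecMulVec, mul_assoc, ← Matrix.mulVec_mulVec, Matrix.dotProduct_mulVec,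
    ← Matrix.mulVec_transpose, ← Matrix.mulVec_mulVec]

theorem transpose_mulVec_mem_squareVertices {Q : Matrix.specialOrthogonalGroup (Fin 3) ℝ}
    (hQ : Q ∈ groupD4 n) (i : Fin 2) : (Q : Tensor2)ᵀ *ᵥ n i ∈ squareVertices n := by
  have h : (fun v => (Q : Tensor2) *ᵥ v) '' squareVertices n = squareVertices n := hQ
  have hi : n i ∈ squareVertices n := by
    fin_cases i <;> simp [squareVertices]
  rw [← h] at hi
  obtain ⟨v, hv, hvi⟩ := hi
  have hvi' : (Q : Tensor2) *ᵥ v = n i := hvi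
  rwa [← hvi', Matrix.mulVec_mulVec, mul_eq_one_comm.mp (mul_transpose_of_mem_SO Q),
    Matrix.one_mulVec]

/-- An element of `D₄` permutes the two lines spanned by `n⁽¹⁾` and `n⁽²⁾`, hence the normal
components of a tensor along them. -/
theorem exists_perm_ddot_conj (hn : ∀ i j, n i ⬝ᵥ n j = if i = j then 1 else 0)
    {Q : Matrix.specialOrthogonalGroup (Fin 3) ℝ} (hQ : Q ∈ groupD4 n) :
    ∃ σ : Equiv.Perm (Fin 2), ∀ i (A : Tensor2),
      ddot (dyadN n i) ((Q : Tensor2) * A * (Q : Tensor2)ᵀ) = ddot (dyadN n (σ i)) A := by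
  have h00 : n 0 ⬝ᵥ n 0 = 1 := by simpa using hn 0 0
  have h11 : n 1 ⬝ᵥ n 1 = 1 := by simpa using hn 1 1
  have hA (i j : Fin 2) (h : (Q : Tensor2)ᵀ *ᵥ n i = n j ∨ (Q : Tensor2)ᵀ *ᵥ n i = -n j)
      (A : Tensor2) : ddot (dyadN n i) ((Q : Tensor2) * A * (Q : Tensor2)ᵀ) =
        ddot (dyadN n j) A := by
    rw [ddot_dyadN_conj, dyadN, ddot_vecMulVec]
    rcases h with h | h <;> simp [h, Matrix.mulVec_neg]
  have hv (i : Fin 2) : ((Q : Tensor2)ᵀ *ᵥ n i = n 0 ∨ (Q : Tensor2)ᵀ *ᵥ n i = -n 0) ∨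
      ((Q : Tensor2)ᵀ *ᵥ n i = n 1 ∨ (Q : Tensor2)ᵀ *ᵥ n i = -n 1) := by
    have := transpose_mulVec_mem_squareVertices hQ i
    simp only [squareVertices, Set.mem_insert_iff, Set.mem_singleton_iff] at this
    tauto
  -- the images of `n⁽¹⁾` and `n⁽²⁾` are orthogonal, so they do not lie on the same line
  have horth : ((Q : Tensor2)ᵀ *ᵥ n 0) ⬝ᵥ ((Q : Tensor2)ᵀ *ᵥ n 1) = 0 := by
    rw [Matrix.dotProduct_mulVec, Matrix.vecMul_transpose, Matrix.mulVec_mulVec,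
      mul_transpose_of_mem_SO, Matrix.one_mulVec, hn]
    simp
  rcases hv 0 with h0 | h0 <;> rcases hv 1 with h1 | h1
  · rcases h0 with h0 | h0 <;> rcases h1 with h1 | h1 <;> simp [h0, h1, h00] at horth
  · refine ⟨1, fun i A => ?_⟩
    fin_cases i
    exacts [hA 0 0 h0 A, hA 1 1 h1 A]
  · refine ⟨Equiv.swap 0 1, fun i A => ?_⟩
    fin_cases i
    exacts [hA 0 1 h0 A, hA 1 0 h1 A]
  · rcases h0 with h0 | h0 <;> rcases h1 with h1 | h1 <;> simp [h0, h1, h11] at horth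

theorem isInvariantOf_Itet (hn : ∀ i j, n i ⬝ᵥ n j = if i = j then 1 else 0) (k : Fin 5) :
    IsInvariantOf (groupD4 n) (Itet n k) := by
  intro Q hQ C _
  obtain ⟨σ, hσ⟩ := exists_perm_ddot_conj hn hQ
  have hcof := cof_conj (mul_transpose_of_mem_SO Q) (det_of_mem_SO Q) C
  fin_cases k
  · simpa [Itet, hσ] using Equiv.sum_comp σ fun i => ddot (dyadN n i) C
  · simpa [Itet, hσ] using Equiv.sum_comp σ fun i => ddot (dyadN n i) C ^ 2
  · simpa [Itet, hcof, hσ] using Equiv.sum_comp σ fun i => ddot (dyadN n i) (cof C)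
  · simpa [Itet, hcof, hσ] using Equiv.sum_comp σ fun i => ddot (dyadN n i) (cof C) ^ 2
  · simpa [Itet, hcof, hσ] using
      Equiv.sum_comp σ fun i => (ddot (dyadN n i) C + ddot (dyadN n i) (cof C)) ^ 2

theorem isInvariantOf_Iiso (G : Subgroup (Matrix.specialOrthogonalGroup (Fin 3) ℝ)) (k : Fin 3) :
    IsInvariantOf G (Iiso k) := by
  intro Q _ C _
  have hQ := mul_eq_one_comm.mp (mul_transpose_of_mem_SO Q)
  fin_cases k
  · exact trace_conj hQ C
  · change (cof _).trace = _
    rw [cof_conj (mul_transpose_of_mem_SO Q) (det_of_mem_SO Q)]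
    exact trace_conj hQ (cof C)
  · exact det_conj (det_of_mem_SO Q) C

/-- A rotation `P` that permutes the vertices `± e₁, ± e₂` of the standard square is the matrix
of an element of `D₄` in the frame of `n`. -/
theorem exists_mem_groupD4 (hn : ∀ i j, n i ⬝ᵥ n j = if i = j then 1 else 0) {P : Tensor2}
    (hP : P * Pᵀ = 1) (hdet : P.det = 1)
    (hsq : (fun v => P *ᵥ v) '' squareVertices ![Pi.single 0 1, Pi.single 1 1] =
      squareVertices ![Pi.single 0 1, Pi.single 1 1]) :
    ∃ Q ∈ groupD4 n, ∀ C, inFrame n ((Q : Tensor2) * C * (Q : Tensor2)ᵀ) =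
      P * inFrame n C * Pᵀ := by
  have hR := frame_mul_transpose hn
  have hmul : ((frame n)ᵀ * P * frame n) * ((frame n)ᵀ * P * frame n)ᵀ = 1 := by
    have h : ((frame n)ᵀ * P * frame n) * ((frame n)ᵀ * P * frame n)ᵀ =
        (frame n)ᵀ * (P * (frame n * (frame n)ᵀ) * Pᵀ) * frame n := by
      simp only [Matrix.transpose_mul, Matrix.transpose_transpose, mul_assoc]
    rw [h, hR, mul_one, hP, mul_one, frame_transpose_mul hn]
  refine ⟨⟨(frame n)ᵀ * P * frame n, Matrix.mem_specialOrthogonalGroup_iff.mpr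
    ⟨(Matrix.mem_orthogonalGroup_iff _ _).mpr hmul, by simp [det_frame hn, hdet]⟩⟩, ?_, fun C => ?_⟩
  · have hsv : squareVertices n =
        (fun v => (frame n)ᵀ *ᵥ v) '' squareVertices ![Pi.single 0 1, Pi.single 1 1] := by
      simp only [squareVertices, Set.image_insert_eq, Set.image_singleton, Matrix.mulVec_neg,
        Matrix.cons_val_zero, Matrix.cons_val_one, Matrix.mulVec_single_one]
      rfl
    change (fun v => ((frame n)ᵀ * P * frame n) *ᵥ v) '' squareVertices n = squareVertices n
    rw [hsv, Set.image_image]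
    conv_rhs => rw [← hsq, Set.image_image]
    simp only [Matrix.mulVec_mulVec, mul_assoc, hR, mul_one]
  · have h : frame n * ((frame n)ᵀ * P * frame n * C * ((frame n)ᵀ * P * frame n)ᵀ) *
        (frame n)ᵀ = (frame n * (frame n)ᵀ) * P * (frame n * C * (frame n)ᵀ) * Pᵀ *
          (frame n * (frame n)ᵀ) := by
      simp only [Matrix.transpose_mul, Matrix.transpose_transpose, mul_assoc]
    change frame n * ((frame n)ᵀ * P * frame n * C * ((frame n)ᵀ * P * frame n)ᵀ) *
      (frame n)ᵀ = _
    rw [h, hR, one_mul, mul_one, inFrame]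

/-- The half turns about the frame axes change the signs of two of the three shear components. -/
theorem exists_halfTurn (hn : ∀ i j, n i ⬝ᵥ n j = if i = j then 1 else 0) {ε : Fin 3 → ℝ}
    (hε : ∀ i, ε i = 1 ∨ ε i = -1) (hdet : ε 0 * ε 1 * ε 2 = 1) :
    ∃ Q ∈ groupD4 n, ∀ C k, frameCoord n k ((Q : Tensor2) * C * (Q : Tensor2)ᵀ) =
      ![1, 1, 1, ε 0 * ε 1, ε 0 * ε 2, ε 1 * ε 2] k * frameCoord n k C := by
  have hsq (i : Fin 3) : ε i * ε i = 1 := by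
    rcases hε i with h | h <;> simp [h]
  obtain ⟨Q, hQ, h⟩ := exists_mem_groupD4 hn (P := Matrix.diagonal ε)
    (by simp [Matrix.diagonal_transpose, Matrix.diagonal_mul_diagonal, hsq])
    (by rw [Matrix.det_diagonal, Fin.prod_univ_three, hdet]) (by
      have h0 : Matrix.diagonal ε *ᵥ Pi.single 0 1 = ε 0 • Pi.single 0 1 := by
        ext i; fin_cases i <;> simp [Matrix.mulVec_diagonal]
      have h1 : Matrix.diagonal ε *ᵥ Pi.single 1 1 = ε 1 • Pi.single 1 1 := by
        ext i; fin_cases i <;> simp [Matrix.mulVec_diagonal]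
      simp only [squareVertices, Set.image_insert_eq, Set.image_singleton, Matrix.mulVec_neg,
        Matrix.cons_val_zero, Matrix.cons_val_one, h0, h1]
      ext v
      simp only [Set.mem_insert_iff, Set.mem_singleton_iff]
      rcases hε 0 with e0 | e0 <;> rcases hε 1 with e1 | e1 <;>
        simp only [e0, e1, one_smul, neg_smul, neg_neg] <;> tauto)
  refine ⟨Q, hQ, fun C k => ?_⟩
  have hk (i j : Fin 3) : inFrame n ((Q : Tensor2) * C * (Q : Tensor2)ᵀ) i j =
      ε i * ε j * inFrame n C i j := by
    rw [h, Matrix.diagonal_transpose, Matrix.mul_diagonal, Matrix.diagonal_mul]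
    ring
  fin_cases k <;> simp [frameCoord, hk, hsq]

/-- The quarter turn about the third frame axis exchanges the first two axes. -/
theorem exists_quarterTurn (hn : ∀ i j, n i ⬝ᵥ n j = if i = j then 1 else 0) :
    ∃ Q ∈ groupD4 n, ∀ C : Tensor2, C.PosDef → ∀ k,
      frameCoord n k ((Q : Tensor2) * C * (Q : Tensor2)ᵀ) =
        ![frameCoord n 1 C, frameCoord n 0 C, frameCoord n 2 C, -frameCoord n 3 C,
          -frameCoord n 5 C, frameCoord n 4 C] k := by
  obtain ⟨Q, hQ, h⟩ := exists_mem_groupD4 hn (P := !![0, -1, 0; 1, 0, 0; 0, 0, 1])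
    (by
      ext i j
      fin_cases i <;> fin_cases j <;> simp [Matrix.mul_apply, Fin.sum_univ_three])
    (by simp [Matrix.det_fin_three]) (by
      have h0 : (!![0, -1, 0; 1, 0, 0; 0, 0, 1] : Tensor2) *ᵥ Pi.single 0 1 = Pi.single 1 1 := by
        ext i; fin_cases i <;> simp
      have h1 : (!![0, -1, 0; 1, 0, 0; 0, 0, 1] : Tensor2) *ᵥ Pi.single 1 1 =
          -Pi.single 0 1 := by
        ext i; fin_cases i <;> simp
      simp only [squareVertices, Set.image_insert_eq, Set.image_singleton, Matrix.mulVec_neg,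
        Matrix.cons_val_zero, Matrix.cons_val_one, h0, h1]
      ext v
      simp only [Set.mem_insert_iff, Set.mem_singleton_iff, neg_neg]
      tauto)
  refine ⟨Q, hQ, fun C hC k => ?_⟩
  fin_cases k <;>
    simp [frameCoord, h, Matrix.mul_apply, Matrix.vecMul, dotProduct, Fin.sum_univ_three,
      inFrame_symm hC 0 1]

end Action

/-! ### The integrity basis -/

/-- Generators of the polynomials in the frame components that the three half turns leave
invariant: `a, b, c, d², e², f², d e f`. -/
def halfTurnInvariant (n : Fin 2 → Fin 3 → ℝ) : Fin 7 → Tensor2 → ℝ :=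
  ![frameCoord n 0, frameCoord n 1, frameCoord n 2, frameCoord n 3 ^ 2, frameCoord n 4 ^ 2,
    frameCoord n 5 ^ 2, frameCoord n 3 * frameCoord n 4 * frameCoord n 5]

section IntegrityBasis

variable {n : Fin 2 → Fin 3 → ℝ}

/-- An invariant polynomial is a polynomial in the generators `a, b, c, d², e², f², d e f`, since
the average over the half turns kills all other terms of its sign decomposition. -/
theorem mem_halfTurnInvariant_of_isInvariantOf
    (hn : ∀ i j, n i ⬝ᵥ n j = if i = j then 1 else 0) {f : Tensor2 → ℝ}
    (hf : f ∈ polynomialsIn (frameCoord n)) (hinv : IsInvariantOf (groupD4 n) f) :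
    f ∈ polynomialsIn (halfTurnInvariant n) := by
  have hS := self_mem_polynomialsIn (halfTurnInvariant n)
  obtain ⟨p, hp⟩ := hf
  obtain ⟨s₀, h₀, s₁, h₁, s₂, h₂, s₃, h₃, s₄, h₄, s₅, h₅, s₆, h₆, hs⟩ :=
    exists_sign_decomposition (polynomialsIn (halfTurnInvariant n))
      (x := frameCoord n 3) (y := frameCoord n 4) (z := frameCoord n 5) (w := frameCoord n)
      (hS 3) (hS 4) (hS 5) (hS 6) (fun k => by
        fin_cases k
        exacts [.inl (hS 0), .inl (hS 1), .inl (hS 2), .inr (.inl rfl), .inr (.inr (.inl rfl)),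
          .inr (.inr (.inr rfl))]) p
  have hf (C : Tensor2) (hC : C.PosDef) : f C = s₀ C + s₁ C * frameCoord n 3 C +
      s₂ C * frameCoord n 4 C + s₃ C * frameCoord n 5 C +
      s₄ C * (frameCoord n 3 C * frameCoord n 4 C) +
      s₅ C * (frameCoord n 3 C * frameCoord n 5 C) +
      s₆ C * (frameCoord n 4 C * frameCoord n 5 C) := by
    rw [hp C hC, ← aeval_tuple_apply, hs]
    simp only [Pi.add_apply, Pi.mul_apply]
  -- the value of the decomposition at the image of `C` under a half turn
  have key (ε : Fin 3 → ℝ) (hε : ∀ i, ε i = 1 ∨ ε i = -1) (hdet : ε 0 * ε 1 * ε 2 = 1)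
      (C : Tensor2) (hC : C.PosDef) : f C = s₀ C + s₁ C * (ε 0 * ε 1 * frameCoord n 3 C) +
      s₂ C * (ε 0 * ε 2 * frameCoord n 4 C) + s₃ C * (ε 1 * ε 2 * frameCoord n 5 C) +
      s₄ C * (ε 0 * ε 1 * frameCoord n 3 C * (ε 0 * ε 2 * frameCoord n 4 C)) +
      s₅ C * (ε 0 * ε 1 * frameCoord n 3 C * (ε 1 * ε 2 * frameCoord n 5 C)) +
      s₆ C * (ε 0 * ε 2 * frameCoord n 4 C * (ε 1 * ε 2 * frameCoord n 5 C)) := by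
    obtain ⟨Q, hQ, hk⟩ := exists_halfTurn hn hε hdet
    have hD := posDef_conj Q hC
    have hgen (k : Fin 7) : halfTurnInvariant n k ((Q : Tensor2) * C * (Q : Tensor2)ᵀ) =
        halfTurnInvariant n k C := by
      have hsq (i : Fin 3) : ε i ^ 2 = 1 := by
        rcases hε i with h | h <;> simp [h]
      have hprod (d e f : ℝ) : ε 0 * ε 1 * d * (ε 0 * ε 2 * e) * (ε 1 * ε 2 * f) = d * e * f := by
        calc _ = (ε 0 ^ 2 * ε 1 ^ 2 * ε 2 ^ 2) * (d * e * f) := by ring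
          _ = d * e * f := by simp [hsq]
      fin_cases k <;> simp [halfTurnInvariant, hk, mul_pow, hsq, hprod]
    have hs {s : Tensor2 → ℝ} (h : s ∈ polynomialsIn (halfTurnInvariant n)) :
        s ((Q : Tensor2) * C * (Q : Tensor2)ᵀ) = s C :=
      apply_eq_of_mem_polynomialsIn h hC hD hgen
    rw [← hinv Q hQ C hC, hf _ hD, hs h₀, hs h₁, hs h₂, hs h₃, hs h₄, hs h₅, hs h₆]
    simp [hk]
  refine mem_polynomialsIn_of_eq h₀ fun C hC => ?_
  have k1 := key ![1, -1, -1] (fun i => by fin_cases i <;> simp) (by simp) C hC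
  have k2 := key ![-1, 1, -1] (fun i => by fin_cases i <;> simp) (by simp) C hC
  have k3 := key ![-1, -1, 1] (fun i => by fin_cases i <;> simp) (by simp) C hC
  simp at k1 k2 k3
  linear_combination (hf C hC + k1 + k2 + k3) / 4

section Swap

variable {ι : Type} {I : ι → Tensor2 → ℝ}

theorem sq_sub_mem (htet : ∀ k, tetInvariant n k ∈ polynomialsIn I) :
    (frameCoord n 0 - frameCoord n 1) ^ 2 ∈ polynomialsIn I := by
  refine mem_polynomialsIn_of_eq
    (sub_mem (pow_mem (htet 0) 2) (Subalgebra.smul_mem _ (htet 1) 4)) fun C _ => ?_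
  simp [tetInvariant]
  ring

theorem sq_sub_sq_mem (htet : ∀ k, tetInvariant n k ∈ polynomialsIn I) :
    (frameCoord n 4 ^ 2 - frameCoord n 5 ^ 2) ^ 2 ∈ polynomialsIn I := by
  refine mem_polynomialsIn_of_eq
    (sub_mem (pow_mem (htet 4) 2) (Subalgebra.smul_mem _ (htet 6) 4)) fun C _ => ?_
  simp [tetInvariant]
  ring

theorem sub_mul_sub_mem (htet : ∀ k, tetInvariant n k ∈ polynomialsIn I) :
    (frameCoord n 0 - frameCoord n 1) * (frameCoord n 4 ^ 2 - frameCoord n 5 ^ 2) ∈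
      polynomialsIn I := by
  refine mem_polynomialsIn_of_eq
    (sub_mem (Subalgebra.smul_mem _ (htet 5) 2) (mul_mem (htet 0) (htet 4))) fun C _ => ?_
  simp [tetInvariant]
  ring

/-- Each generator is fixed by the exchange `a ↔ b, e² ↔ f²`, or half the sum of its orbit plus or
minus half of `a - b` or of `e² - f²`. -/
theorem halfTurnInvariant_decomposition (htet : ∀ k, tetInvariant n k ∈ polynomialsIn I)
    (hshear : frameCoord n 3 * frameCoord n 4 * frameCoord n 5 ∈ polynomialsIn I) (k : Fin 7) :
    ∃ r₀ ∈ polynomialsIn I, ∃ r₁ ∈ polynomialsIn I, ∃ r₂ ∈ polynomialsIn I,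
      halfTurnInvariant n k = r₀ + r₁ * (frameCoord n 0 - frameCoord n 1) +
        r₂ * (frameCoord n 4 ^ 2 - frameCoord n 5 ^ 2) := by
  have hconst (r : ℝ) : algebraMap ℝ (Tensor2 → ℝ) r ∈ polynomialsIn I :=
    (polynomialsIn I).algebraMap_mem r
  match k with
  | 0 =>
    refine ⟨_, Subalgebra.smul_mem _ (htet 0) (1 / 2), _, hconst (1 / 2), 0, zero_mem _, ?_⟩
    ext C
    simp [tetInvariant, halfTurnInvariant]
    ring
  | 1 =>
    refine ⟨_, Subalgebra.smul_mem _ (htet 0) (1 / 2), _, hconst (-(1 / 2)), 0, zero_mem _, ?_⟩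
    ext C
    simp [tetInvariant, halfTurnInvariant]
    ring
  | 2 =>
    refine ⟨_, htet 2, 0, zero_mem _, 0, zero_mem _, ?_⟩
    simp [tetInvariant, halfTurnInvariant]
  | 3 =>
    refine ⟨_, htet 3, 0, zero_mem _, 0, zero_mem _, ?_⟩
    simp [tetInvariant, halfTurnInvariant]
  | 4 =>
    refine ⟨_, Subalgebra.smul_mem _ (htet 4) (1 / 2), 0, zero_mem _, _, hconst (1 / 2), ?_⟩
    ext C
    simp [tetInvariant, halfTurnInvariant]
    ring
  | 5 =>
    refine ⟨_, Subalgebra.smul_mem _ (htet 4) (1 / 2), 0, zero_mem _, _, hconst (-(1 / 2)), ?_⟩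
    ext C
    simp [tetInvariant, halfTurnInvariant]
    ring
  | 6 =>
    refine ⟨_, hshear, 0, zero_mem _, 0, zero_mem _, ?_⟩
    simp [halfTurnInvariant]

end Swap

/-- An invariant polynomial is a polynomial in any tuple of invariants that generates the
elementary ones, since the average over the quarter turn kills the multiples of `a - b` and
`e² - f²`. -/
theorem mem_polynomialsIn_of_isInvariantOf (hn : ∀ i j, n i ⬝ᵥ n j = if i = j then 1 else 0)
    {ι : Type} {I : ι → Tensor2 → ℝ} (hI : ∀ k, IsInvariantOf (groupD4 n) (I k))
    (htet : ∀ k, tetInvariant n k ∈ polynomialsIn I)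
    (hshear : frameCoord n 3 * frameCoord n 4 * frameCoord n 5 ∈ polynomialsIn I)
    {f : Tensor2 → ℝ} (hf : f ∈ polynomialsIn (frameCoord n))
    (hinv : IsInvariantOf (groupD4 n) f) : f ∈ polynomialsIn I := by
  obtain ⟨p, hp⟩ := mem_halfTurnInvariant_of_isInvariantOf hn hf hinv
  obtain ⟨t₀, h₀, t₁, h₁, t₂, h₂, ht⟩ :=
    exists_swap_decomposition (polynomialsIn I) (u := frameCoord n 0 - frameCoord n 1)
      (v := frameCoord n 4 ^ 2 - frameCoord n 5 ^ 2) (w := halfTurnInvariant n)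
      (sq_sub_mem htet) (sq_sub_sq_mem htet) (sub_mul_sub_mem htet)
      (halfTurnInvariant_decomposition htet hshear) p
  have hf (C : Tensor2) (hC : C.PosDef) : f C = t₀ C +
      t₁ C * (frameCoord n 0 C - frameCoord n 1 C) +
      t₂ C * (frameCoord n 4 C ^ 2 - frameCoord n 5 C ^ 2) := by
    rw [hp C hC, ← aeval_tuple_apply, ht]
    simp only [Pi.add_apply, Pi.mul_apply, Pi.sub_apply, Pi.pow_apply]
  refine mem_polynomialsIn_of_eq h₀ fun C hC => ?_
  obtain ⟨Q, hQ, hk⟩ := exists_quarterTurn hn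
  have hD := posDef_conj Q hC
  have hs {s : Tensor2 → ℝ} (h : s ∈ polynomialsIn I) :
      s ((Q : Tensor2) * C * (Q : Tensor2)ᵀ) = s C :=
    apply_eq_of_mem_polynomialsIn h hC hD fun k => hI k Q hQ C hC
  have hQf := hf _ hD
  rw [hinv Q hQ C hC, hs h₀, hs h₁, hs h₂] at hQf
  simp [hk C hC] at hQf
  linear_combination (hf C hC + hQf) / 2

theorem isIntegrityBasis_Itet_Iiso (hn : ∀ i j, n i ⬝ᵥ n j = if i = j then 1 else 0) :
    IsIntegrityBasis (groupD4 n) (Sum.elim (Itet n) Iiso) := by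
  have hS := self_mem_polynomialsIn (Sum.elim (Itet n) Iiso)
  have htet := tetInvariant_mem_of_Itet hn (fun k => hS (.inl k)) fun k => hS (.inr k.castSucc)
  have hinv : ∀ k, IsInvariantOf (groupD4 n) (Sum.elim (Itet n) Iiso k)
    | .inl k => isInvariantOf_Itet hn k
    | .inr k => isInvariantOf_Iiso _ k
  have hframe {f : Tensor2 → ℝ} (h : f ∈ polynomialsIn (frameCoord n)) :
      IsPolynomialFunction f := polynomialsIn_trans h (frameCoord_mem_entries n)
  have hc := self_mem_polynomialsIn (frameCoord n)
  have htet' (k : Fin 7) : tetInvariant n k ∈ polynomialsIn (frameCoord n) := by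
    fin_cases k
    exacts [add_mem (hc 0) (hc 1), mul_mem (hc 0) (hc 1), hc 2, pow_mem (hc 3) 2,
      add_mem (pow_mem (hc 4) 2) (pow_mem (hc 5) 2),
      add_mem (mul_mem (hc 0) (pow_mem (hc 4) 2)) (mul_mem (hc 1) (pow_mem (hc 5) 2)),
      mul_mem (pow_mem (hc 4) 2) (pow_mem (hc 5) 2)]
  have hdet : Iiso 2 ∈ polynomialsIn (frameCoord n) := by
    open MvPolynomial in
    refine ⟨X 0 * X 1 * X 2 + C 2 * (X 3 * X 4 * X 5) - X 0 * X 5 ^ 2 - X 1 * X 4 ^ 2 -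
      X 2 * X 3 ^ 2, fun A hA => ?_⟩
    simp [Iiso_apply hn hA (frameCoord_eta n A)]
  have hpoly : ∀ k, IsPolynomialFunction (Sum.elim (Itet n) Iiso k)
    | .inl k => hframe (polynomialsIn_trans (Itet_mem_tetInvariant hn k) htet')
    | .inr 0 => hframe (polynomialsIn_trans (Iiso_mem_tetInvariant hn 0) htet')
    | .inr 1 => hframe (polynomialsIn_trans (Iiso_mem_tetInvariant hn 1) htet')
    | .inr 2 => hframe hdet
  refine ⟨fun k => ⟨hpoly k, hinv k⟩, fun f hf hfinv => ?_⟩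
  exact mem_polynomialsIn_of_isInvariantOf hn hinv htet (shear_product_mem hn htet (hS (.inr 2)))
    (polynomialsIn_trans hf fun ij => entry_mem_frameCoord hn ij.1 ij.2) hfinv

end IntegrityBasis

theorem mainTheorem2 (n : Fin 2 → Fin 3 → ℝ)
    (hn : ∀ i j, n i ⬝ᵥ n j = if i = j then 1 else 0) :
    -- the invariants are polyconvex
    (∀ k, IsPolyconvex (Itet n k)) ∧ (∀ k, IsPolyconvex (Iiso k)) ∧
    -- together they are an integrity basis of the tetragonal group
    IsIntegrityBasis (groupD4 n) (Sum.elim (Itet n) Iiso) ∧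
    -- the general invariants as polynomials in the polyconvex ones
    (∀ k, IsPolynomialIn (Sum.elim (Itet n) fun l : Fin 2 => Iiso l.castSucc) (Jtet n k)) ∧
    (∀ k : Fin 2, IsPolynomialIn (Sum.elim (Itet n) fun l : Fin 2 => Iiso l.castSucc)
      (Jiso k.castSucc)) ∧
    (∀ k, IsPolynomialIn Iiso (Jiso k)) ∧
    -- the polyconvex invariants as polynomials in the general ones
    (∀ k, IsPolynomialIn (Sum.elim (Jtet n) fun l : Fin 2 => Jiso l.castSucc) (Itet n k)) ∧
    (∀ k, IsPolynomialIn Jiso (Iiso k)) := by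
  have hI := self_mem_polynomialsIn (Sum.elim (Itet n) fun l : Fin 2 => Iiso l.castSucc)
  have hJ := self_mem_polynomialsIn (Sum.elim (Jtet n) fun l : Fin 2 => Jiso l.castSucc)
  have hI' := tetInvariant_mem_of_Itet hn (fun k => hI (.inl k)) fun k => hI (.inr k)
  have hJ' := tetInvariant_mem_of_Jtet hn (fun k => hJ (.inl k)) fun k => hJ (.inr k)
  exact ⟨isPolyconvex_Itet n, isPolyconvex_Iiso, isIntegrityBasis_Itet_Iiso hn,
    fun k => polynomialsIn_trans (Jtet_mem_tetInvariant hn k) hI',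
    fun k => polynomialsIn_trans (Jiso_mem_tetInvariant hn k) hI',
    isPolynomialIn_Iiso_Jiso,
    fun k => polynomialsIn_trans (Itet_mem_tetInvariant hn k) hJ',
    isPolynomialIn_Jiso_Iiso⟩
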